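/- Let $(\Omega,\mathcal F,(\mathcal F_t)_{t\ge 0},\mathbb Q)$ be a filtered probability space satisfying the usual conditions and let $W$ be a standard real $(\mathcal F_t)$-Brownian motion. Let $T\ge 0$, and let $K$ be a real function that is absolutely continuous on $[0,T]$ and whose (almost everywhere defined) derivative $K'$ is square-integrable on $[0,T]$. For $t\in[0,T]$ consider the Wiener integrals $$X_t=\int_0^t K(t-s)\,dW_s,\qquad Y_t=\int_0^t K'(t-s)\,dW_s,$$ each of which is determined up to a $\mathbb Q$-null set. Then both are well defined for every $t\in[0,T]$, $X=(X_t)_{t\in[0,T]}$ has a version with almost surely continuous paths, and $Y=(Y_t)_{t\in[0,T]}$ has a progressively measurable version. Moreover, for every version of $X$ with almost surely càdlàg paths and every jointly measurable version of $Y$, the process $X$ is a semimartingale on $[0,T]$ with respect to $(\mathcal F_t)$ (the sum of a càdlàg local martingale and an adapted càdlàg process of finite variation), and its dynamics are $$dX_t=K(0)\,dW_t+\Big(\int_0^t K'(t-s)\,dW_s\Big)dt,\qquad X_0=0,$$ that is, almost surely, $\int_0^T|Y_r|\,dr<\infty$ and, for all $t\in[0,T]$ simultaneously, $$X_t=K(0)W_t+\int_0^t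 Y_r\,dr .$$ -/

import Mathlib

open MeasureTheory ProbabilityTheory Set Filter
open scoped NNReal ENNReal Topology

noncomputable section

namespace GaussianVolterra

/-- The usual conditions for a filtration indexed by `[0, ∞)`: right-continuity, and every
`P`-null set (measurable or not) belongs to `𝓕 0`. -/
structure UsualConditions {Ω : Type*} {mΩ : MeasurableSpace Ω} (𝓕 : Filtration ℝ≥0 mΩ)
    (P : Measure Ω) : Prop where
  rightContinuous : 𝓕.IsRightContinuous
  complete : ∀ A : Set Ω, P A = 0 → MeasurableSet[𝓕 0] A

/-- `W` is a standard real Brownian motion with respect to the filtration `𝓕`. -/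
structure IsBrownianMotion {Ω : Type*} {mΩ : MeasurableSpace Ω} (W : ℝ≥0 → Ω → ℝ)
    (𝓕 : Filtration ℝ≥0 mΩ) (P : Measure Ω) : Prop extends IsBrownianReal W P where
  adapted : StronglyAdapted 𝓕 W
  indep : ∀ s t : ℝ≥0, s ≤ t →
    Indep (MeasurableSpace.comap (fun ω ↦ W t ω - W s ω) inferInstance) (𝓕 s) P

/-! ### The Wiener integral -/

/-- The space `L²((0, ∞))` of deterministic square-integrable integrands. -/
abbrev Integrands : Type := Lp ℝ 2 ((volume : Measure ℝ).restrict (Ioi 0))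

/-- The step function `∑ cᵢ 1_{(0, tᵢ]}`, where `c` is the finitely supported family `tᵢ ↦ cᵢ`. -/
def stepFunction : (ℝ≥0 →₀ ℝ) →ₗ[ℝ] Integrands :=
  Finsupp.linearCombination ℝ fun t : ℝ≥0 ↦
    indicatorConstLp (μ := (volume : Measure ℝ).restrict (Ioi 0)) 2
      (measurableSet_Ioc (a := (0 : ℝ)) (b := (t : ℝ)))
      (((Measure.restrict_apply_le _ _).trans_lt measure_Ioc_lt_top).ne) (1 : ℝ)

theorem memLp_eval {Ω : Type*} {mΩ : MeasurableSpace Ω} {W : ℝ≥0 → Ω → ℝ} {P : Measure Ω}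
    (hW : IsPreBrownianReal W P) (t : ℝ≥0) : MemLp (W t) 2 P :=
  (hW.isGaussianProcess.hasGaussianLaw_eval t).memLp_two

/-- The integral `∑ cᵢ W_{tᵢ}` of the step function `∑ cᵢ 1_{(0, tᵢ]}` (recall `W_0 = 0`). -/
def stepIntegral {Ω : Type*} {mΩ : MeasurableSpace Ω} {W : ℝ≥0 → Ω → ℝ} {P : Measure Ω}
    (hW : IsPreBrownianReal W P) : (ℝ≥0 →₀ ℝ) →ₗ[ℝ] Lp ℝ 2 P :=
  Finsupp.linearCombination ℝ fun t : ℝ≥0 ↦ (memLp_eval hW t).toLp (W t)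

/-- The Wiener integral `f ↦ ∫_0^∞ f(s) dW_s`: the continuous linear extension of the integral of
step functions from the dense subspace of step functions to all of `L²((0, ∞))`. -/
def wienerIntegral {Ω : Type*} {mΩ : MeasurableSpace Ω} {W : ℝ≥0 → Ω → ℝ} {P : Measure Ω}
    (hW : IsPreBrownianReal W P) : Integrands →L[ℝ] Lp ℝ 2 P :=
  (stepIntegral hW).extendOfNorm stepFunction

/-- Step functions are dense in `L²((0, ∞))`. -/
theorem denseRange_stepFunction : DenseRange stepFunction := by
  have key : (LinearMap.range stepFunction).topologicalClosure = ⊤ := by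
    rw [Submodule.topologicalClosure_eq_top_iff, Submodule.eq_bot_iff]
    intro g hg
    rw [Submodule.mem_orthogonal] at hg
    have h0 (t : ℝ≥0) : ∫ s in Ioc (0 : ℝ) t, (Ioi (0 : ℝ)).indicator g s = 0 := by
      have h := hg (stepFunction (Finsupp.single t 1)) ⟨_, rfl⟩
      rw [stepFunction, Finsupp.linearCombination_single, one_smul,
        L2.inner_indicatorConstLp_one, Measure.restrict_restrict measurableSet_Ioc,
        inter_eq_left.2 (fun x hx ↦ hx.1)] at h
      exact (setIntegral_congr_fun measurableSet_Ioc fun x hx ↦ indicator_of_mem hx.1 _).trans h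
    set G : ℝ → ℝ := (Ioi (0 : ℝ)).indicator g with hG
    have hGm : MemLp G 2 volume := (memLp_indicator_iff_restrict measurableSet_Ioi).2 (Lp.memLp g)
    have hGl : LocallyIntegrable G volume := hGm.locallyIntegrable (by norm_num)
    have hint (x : ℝ) : ∫ s in (0 : ℝ)..x, G s = 0 := by
      rcases le_total 0 x with hx | hx
      · rw [intervalIntegral.integral_of_le hx]
        exact h0 ⟨x, hx⟩
      · rw [intervalIntegral.integral_of_ge hx, neg_eq_zero]
        refine setIntegral_eq_zero_of_forall_eq_zero fun s hs ↦ ?_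
        exact indicator_of_notMem (not_lt.2 hs.2) _
    have hae : ∀ᵐ x : ℝ, G x = 0 := by
      filter_upwards [LocallyIntegrable.ae_hasDerivAt_integral hGl] with x hx
      have h1 := hx 0
      simp only [hint] at h1
      exact h1.unique (hasDerivAt_const x 0)
    rw [Lp.eq_zero_iff_ae_eq_zero]
    rw [EventuallyEq, ae_restrict_iff' measurableSet_Ioi]
    filter_upwards [hae] with x hx hx0
    simpa [hG, indicator_of_mem hx0] using hx
  rw [DenseRange, ← LinearMap.coe_range, ← dense_closure]
  have := congrArg (fun S : Submodule ℝ Integrands ↦ (S : Set Integrands)) key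
  simp only [Submodule.topologicalClosure_coe, Submodule.top_coe] at this
  rw [this]
  exact dense_univ

/-- The integral of step functions is an isometry. -/
theorem norm_stepIntegral {Ω : Type*} {mΩ : MeasurableSpace Ω} {W : ℝ≥0 → Ω → ℝ} {P : Measure Ω}
    (hW : IsPreBrownianReal W P) (c : ℝ≥0 →₀ ℝ) : ‖stepIntegral hW c‖ = ‖stepFunction c‖ := by
  have := hW.isGaussianProcess.isProbabilityMeasure
  have hP (s t : ℝ≥0) : inner ℝ ((memLp_eval hW s).toLp (W s)) ((memLp_eval hW t).toLp (W t))
      = ((min s t : ℝ≥0) : ℝ) := by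
    rw [L2.inner_def, ← hW.covariance_eval s t,
      covariance_eq_sub (memLp_eval hW s) (memLp_eval hW t), hW.integral_eval, zero_mul, sub_zero]
    refine integral_congr_ae ?_
    filter_upwards [(memLp_eval hW s).coeFn_toLp, (memLp_eval hW t).coeFn_toLp] with ω h1 h2
    simp [h1, h2, mul_comm]
  have hsq : inner ℝ (stepIntegral hW c) (stepIntegral hW c)
      = inner ℝ (stepFunction c) (stepFunction c) := by
    simp only [stepIntegral, stepFunction, Finsupp.linearCombination_apply, Finsupp.sum_inner,
      Finsupp.inner_sum, inner_smul_left, inner_smul_right, hP,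
      L2.real_inner_indicatorConstLp_one_indicatorConstLp_one]
    refine Finsupp.sum_congr fun s _ ↦ congrArg _ (Finsupp.sum_congr fun t _ ↦ congrArg _ ?_)
    rw [measureReal_restrict_apply (measurableSet_Ioc.inter measurableSet_Ioc), Ioc_inter_Ioc,
      max_self, inter_eq_left.2 (Ioc_subset_Ioi_self)]
    simp [Real.volume_real_Ioc]
  rw [real_inner_self_eq_norm_sq, real_inner_self_eq_norm_sq] at hsq
  exact (sq_eq_sq₀ (norm_nonneg _) (norm_nonneg _)).1 hsq

/-- The Wiener integral extends the integral of step functions. -/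
theorem wienerIntegral_stepFunction {Ω : Type*} {mΩ : MeasurableSpace Ω} {W : ℝ≥0 → Ω → ℝ}
    {P : Measure Ω} (hW : IsPreBrownianReal W P) (c : ℝ≥0 →₀ ℝ) :
    wienerIntegral hW (stepFunction c) = stepIntegral hW c :=
  LinearMap.extendOfNorm_eq denseRange_stepFunction
    ⟨1, fun c ↦ by rw [one_mul, norm_stepIntegral hW c]⟩ c

/-- The random variable `Y` is (a version of) `∫_0^t f(s) dW_s`; in particular `f` is
square-integrable on `(0, t]`. -/
def IsWienerIntegral {Ω : Type*} {mΩ : MeasurableSpace Ω} {W : ℝ≥0 → Ω → ℝ} {P : Measure Ω}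
    (hW : IsPreBrownianReal W P) (f : ℝ → ℝ) (t : ℝ≥0) (Y : Ω → ℝ) : Prop :=
  ∃ hf : MemLp ((Ioc (0 : ℝ) t).indicator f) 2 ((volume : Measure ℝ).restrict (Ioi 0)),
    Y =ᵐ[P] wienerIntegral hW (hf.toLp _)

/-- On the time interval `[0, T]`, the process `X` is (a version of) the Gaussian Volterra process
`t ↦ ∫_0^t k(t - s) dW_s`. -/
def IsVolterraProcess {Ω : Type*} {mΩ : MeasurableSpace Ω} {W : ℝ≥0 → Ω → ℝ} {P : Measure Ω}
    (hW : IsPreBrownianReal W P) (k : ℝ → ℝ) (T : ℝ≥0) (X : ℝ≥0 → Ω → ℝ) : Prop :=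
  ∀ t : ℝ≥0, t ≤ T → IsWienerIntegral hW (fun s ↦ k (t - s)) t (X t)

/-! ### Semimartingales -/

/-- Right-continuous with left limits. -/
def IsCadlag (x : ℝ≥0 → ℝ) : Prop :=
  ∀ t, ContinuousWithinAt x (Ici t) t ∧ ∃ l, Tendsto x (𝓝[<] t) (𝓝 l)

/-- Càdlàg local martingales. -/
def IsLocalMartingale {Ω : Type*} {mΩ : MeasurableSpace Ω} (M : ℝ≥0 → Ω → ℝ)
    (𝓕 : Filtration ℝ≥0 mΩ) (P : Measure Ω) : Prop :=
  Locally (fun N ↦ Martingale N 𝓕 P ∧ ∀ᵐ ω ∂P, IsCadlag (N · ω)) 𝓕 M P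

/-- Adapted càdlàg processes with paths of finite variation on compact intervals. -/
structure IsFiniteVariationProcess {Ω : Type*} {mΩ : MeasurableSpace Ω} (A : ℝ≥0 → Ω → ℝ)
    (𝓕 : Filtration ℝ≥0 mΩ) (P : Measure Ω) : Prop where
  adapted : StronglyAdapted 𝓕 A
  cadlag : ∀ᵐ ω ∂P, IsCadlag (A · ω)
  finiteVariation : ∀ᵐ ω ∂P, LocallyBoundedVariationOn (A · ω) univ

/-- `X` is, up to indistinguishability, the sum of a local martingale and a process of finite
variation. -/
def IsSemimartingale {Ω : Type*} {mΩ : MeasurableSpace Ω} (X : ℝ≥0 → Ω → ℝ)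
    (𝓕 : Filtration ℝ≥0 mΩ) (P : Measure Ω) : Prop :=
  ∃ M A : ℝ≥0 → Ω → ℝ, IsLocalMartingale M 𝓕 P ∧ IsFiniteVariationProcess A 𝓕 P ∧
    ∀ᵐ ω ∂P, ∀ t, X t ω = M t ω + A t ω

/-- The process `X` considered on `[0, T]`, continued by the constant value `X_T` after `T`. -/
def upTo {Ω : Type*} (T : ℝ≥0) (X : ℝ≥0 → Ω → ℝ) : ℝ≥0 → Ω → ℝ := fun t ω ↦ X (min t T) ω

end GaussianVolterra

end

noncomputable section

namespace GaussianVolterra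

/-! ### Integrating square-integrable random functions pathwise -/

/-! Write g for K' on [0,T), extended by zero. The fundamental theorem of calculus gives, for s > 0
and t ≤ T, 1_{(0,t]}(s) K(t-s) = K(0) 1_{(0,t]}(s) + ∫_0^t g(r-s) dr. Translation is continuous in
L², so the last term is the Bochner integral of the continuous curve r ↦ g(r-·)
(`indicator_kernel_ae_eq`). The Wiener integral is continuous and linear, hence commutes with this
integral; this is all the stochastic Fubini theorem that is needed. `coeFn_intervalIntegral_Lp`
turns Bochner integrals in L² into pointwise ones, which yields the dynamics almost surely for each
fixed t (`isWienerIntegral_iff`).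

Both sides have right-continuous paths on [0,T], so a countable dense set of times removes the
dependence of the null set on t. The martingale part is K(0)W; the rest has absolutely continuous
paths, and is adapted because each X_t is 𝓕_t-measurable up to a null set and 𝓕 is complete. The
drift is a continuous curve in L²(P), so discretising time gives a progressive version. -/

theorem setIntegral_norm_le_mul_norm {E : Type*} {mE : MeasurableSpace E} {μ : Measure E}
    {A : Set E} (hA : MeasurableSet A) (hμA : μ A ≠ ∞) (y : Lp ℝ 2 μ) :
    ∫ e in A, ‖y e‖ ∂μ ≤ ‖indicatorConstLp 2 hA hμA (1 : ℝ)‖ * ‖y‖ := by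
  have h1 : (fun e ↦ ‖y e‖) =ᵐ[μ] (Lp.memLp y).norm.toLp := (Lp.memLp y).norm.coeFn_toLp.symm
  have h2 : ‖(Lp.memLp y).norm.toLp‖ = ‖y‖ := by
    rw [Lp.norm_toLp, eLpNorm_norm, Lp.norm_def]
  -- Cauchy–Schwarz for 1_A and |y|.
  rw [setIntegral_congr_ae hA (g := (Lp.memLp y).norm.toLp) (h1.mono fun e he _ ↦ he),
    ← L2.inner_indicatorConstLp_one hA hμA, ← h2]
  exact real_inner_le_norm _ _

/-- The L¹(A) norm of Y_r is at most ‖1_A‖ ‖y r‖, which is bounded on [a,b] by continuity.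
Localising to A of finite measure lets the result serve Lebesgue measure on (0,∞) as well as P. -/
theorem integrable_uncurry_of_continuous_Lp {E : Type*} {mE : MeasurableSpace E} {μ : Measure E}
    {a b : ℝ} {y : ℝ → Lp ℝ 2 μ} (hy : Continuous y) {Y : ℝ → E → ℝ}
    (hY : Measurable (Function.uncurry Y)) (hYy : ∀ r ∈ Ioc a b, Y r =ᵐ[μ] y r)
    {A : Set E} (hA : MeasurableSet A) (hμA : μ A ≠ ∞) :
    Integrable (Function.uncurry Y) ((volume.restrict (Ioc a b)).prod (μ.restrict A)) := by
  have : IsFiniteMeasure (μ.restrict A) := ⟨by simpa using hμA.lt_top⟩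
  refine (integrable_prod_iff hY.aestronglyMeasurable).2 ⟨?_, ?_⟩
  · filter_upwards [ae_restrict_mem measurableSet_Ioc] with r hr
    refine Integrable.congr (((Lp.memLp (y r)).restrict A).integrable (by norm_num))
      (ae_restrict_of_ae (hYy r hr).symm)
  · have hb : Integrable (fun r ↦ ‖indicatorConstLp 2 hA hμA (1 : ℝ)‖ * ‖y r‖)
        (volume.restrict (Ioc a b)) :=
      ((continuous_const.mul hy.norm).integrableOn_Icc).mono_set Ioc_subset_Icc_self
    refine hb.mono' ?_ ?_
    · exact (hY.norm.aestronglyMeasurable.integral_prod_right')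
    · filter_upwards [ae_restrict_mem measurableSet_Ioc] with r hr
      rw [Real.norm_of_nonneg (integral_nonneg fun _ ↦ norm_nonneg _)]
      refine le_trans (le_of_eq ?_) (setIntegral_norm_le_mul_norm hA hμA (y r))
      refine integral_congr_ae (ae_restrict_of_ae ?_)
      filter_upwards [hYy r hr] with e he
      simp [he]

/-- The Bochner integral of a continuous curve in `L²` is computed pointwise. -/
theorem coeFn_intervalIntegral_Lp {E : Type*} {mE : MeasurableSpace E} {μ : Measure E}
    [SigmaFinite μ] {a b : ℝ} (hab : a ≤ b) {y : ℝ → Lp ℝ 2 μ} (hy : Continuous y)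
    {Y : ℝ → E → ℝ} (hY : Measurable (Function.uncurry Y))
    (hYy : ∀ r ∈ Ioc a b, Y r =ᵐ[μ] y r) :
    (∫ r in a..b, y r : Lp ℝ 2 μ) =ᵐ[μ] fun e ↦ ∫ r in a..b, Y r e := by
  refine ae_eq_of_forall_setIntegral_eq_of_sigmaFinite (fun A hA hμA ↦ ?_) (fun A hA hμA ↦ ?_)
    fun A hA hμA ↦ ?_
  · have : IsFiniteMeasure (μ.restrict A) := ⟨by simpa using hμA⟩
    exact ((Lp.memLp _).restrict A).integrable (by norm_num)
  · simp only [intervalIntegral.integral_of_le hab]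
    exact (integrable_uncurry_of_continuous_Lp hy hY hYy hA hμA.ne).integral_prod_right
  · have hint := integrable_uncurry_of_continuous_Lp hy hY hYy hA hμA.ne
    -- Pairing with 1_A is a continuous functional, so it passes under the Bochner integral; what
    -- remains is the classical Fubini theorem.
    rw [← L2.inner_indicatorConstLp_one (𝕜 := ℝ) hA hμA.ne, ← innerSL_apply_apply (𝕜 := ℝ),
      ← ContinuousLinearMap.intervalIntegral_comp_comm _ (hy.intervalIntegrable a b)]
    simp only [intervalIntegral.integral_of_le hab]
    rw [← integral_integral_swap hint]
    refine setIntegral_congr_fun measurableSet_Ioc fun r hr ↦ ?_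
    simp only [innerSL_apply_apply]
    rw [L2.inner_indicatorConstLp_one hA hμA.ne]
    exact integral_congr_ae (ae_restrict_of_ae (hYy r hr).symm)

theorem ae_intervalIntegrable_of_continuous_Lp {E : Type*} {mE : MeasurableSpace E}
    {μ : Measure E} [IsFiniteMeasure μ] {a b : ℝ} (hab : a ≤ b) {y : ℝ → Lp ℝ 2 μ}
    (hy : Continuous y) {Y : ℝ → E → ℝ} (hY : Measurable (Function.uncurry Y))
    (hYy : ∀ r ∈ Ioc a b, Y r =ᵐ[μ] y r) :
    ∀ᵐ e ∂μ, IntervalIntegrable (Y · e) volume a b := by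
  have h := integrable_uncurry_of_continuous_Lp hy hY hYy .univ (measure_ne_top μ _)
  rw [Measure.restrict_univ] at h
  filter_upwards [h.prod_left_ae] with e he
  exact (intervalIntegrable_iff_integrableOn_Ioc_of_le hab).2 he

/-! ### Progressively measurable versions -/

/-- The time enters only through an integer, so measurability on [0,i] × Ω reduces to countably many
𝓕_i-measurable slices. For δ = 0 the process is constantly Z_0. -/
theorem isStronglyProgressive_floor {Ω : Type*} {mΩ : MeasurableSpace Ω}
    {𝓕 : Filtration ℝ≥0 mΩ} {Z : ℝ≥0 → Ω → ℝ} (hZ : StronglyAdapted 𝓕 Z) (δ : ℝ≥0) :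
    IsStronglyProgressive 𝓕 fun t ↦ Z (⌊t / δ⌋₊ * δ) := by
  intro i
  have hle (t : ℝ≥0) : ⌊t / δ⌋₊ * δ ≤ t := by
    rcases eq_or_ne δ 0 with rfl | hδ
    · simp
    · calc (⌊t / δ⌋₊ : ℝ≥0) * δ ≤ t / δ * δ := by gcongr; exact Nat.floor_le zero_le
        _ = t := div_mul_cancel₀ t hδ
  -- Capping the time at i makes every slice 𝓕_i-measurable, and changes nothing where t ≤ i since
  -- rounding down stays below t.
  have hG : Measurable[(inferInstance : MeasurableSpace ℕ).prod (𝓕 i)]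
      fun p : ℕ × Ω ↦ Z (min (p.1 * δ) i) p.2 := by
    let _ : MeasurableSpace Ω := 𝓕 i
    exact measurable_from_prod_countable_right fun k ↦
      ((hZ (min (k * δ) i)).mono (𝓕.mono (min_le_right _ _))).measurable
  let _ : MeasurableSpace Ω := 𝓕 i
  have hφ : Measurable fun p : Iic i × Ω ↦ ((⌊(p.1 : ℝ≥0) / δ⌋₊ : ℕ), p.2) :=
    (Nat.measurable_floor.comp
      (((measurable_subtype_coe.comp measurable_fst)).div_const δ)).prodMk measurable_snd
  refine (congrArg StronglyMeasurable (funext fun p ↦ ?_)).mpr (hG.comp hφ).stronglyMeasurable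
  simp only [Function.comp]
  rw [min_eq_left ((hle _).trans p.1.2)]

/-- A uniformly `L²`-continuous adapted process has a progressively measurable version. -/
theorem exists_isStronglyProgressive_version {Ω : Type*} {mΩ : MeasurableSpace Ω} {P : Measure Ω}
    {𝓕 : Filtration ℝ≥0 mΩ} {f : ℝ≥0 → Lp ℝ 2 P} (hf : UniformContinuous f)
    (hm : ∀ t, AEStronglyMeasurable[𝓕 t] (f t) P) :
    ∃ Y : ℝ≥0 → Ω → ℝ, IsStronglyProgressive 𝓕 Y ∧ ∀ t, Y t =ᵐ[P] f t := by
  choose Z hZ hfZ using hm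
  -- A mesh with summable L² errors, uniform in t: the same sequence of step processes then
  -- converges almost surely at every fixed time, with no subsequence depending on t.
  have hδ (n : ℕ) : ∃ δ : ℝ≥0, 0 < δ ∧ ∀ s t, dist s t ≤ δ → dist (f s) (f t) < (1 / 2) ^ n := by
    obtain ⟨δ, h0, h⟩ := Metric.uniformContinuous_iff.1 hf ((1 / 2) ^ n) (by positivity)
    refine ⟨(δ / 2).toNNReal, by simpa using h0, fun s t hst ↦ h (hst.trans_lt ?_)⟩
    rw [Real.coe_toNNReal _ (by positivity)]
    linarith
  choose δ hδ0 hδ using hδ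
  set τ : ℕ → ℝ≥0 → ℝ≥0 := fun n t ↦ ⌊t / δ n⌋₊ * δ n with hτ
  have hτd (n : ℕ) (t : ℝ≥0) : dist (τ n t) t ≤ δ n := by
    have h1 : τ n t ≤ t := by
      calc (⌊t / δ n⌋₊ : ℝ≥0) * δ n ≤ t / δ n * δ n := by gcongr; exact Nat.floor_le zero_le
        _ = t := div_mul_cancel₀ t (hδ0 n).ne'
    have h2 : t ≤ τ n t + δ n := by
      calc t = t / δ n * δ n := (div_mul_cancel₀ t (hδ0 n).ne').symm
        _ ≤ (⌊t / δ n⌋₊ + 1) * δ n := by gcongr; exact (Nat.lt_floor_add_one _).le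
        _ = τ n t + δ n := by simp [hτ, add_mul]
    rw [NNReal.dist_eq, abs_sub_comm, abs_of_nonneg (sub_nonneg.2 (by exact_mod_cast h1))]
    have : (t : ℝ) ≤ τ n t + δ n := by exact_mod_cast h2
    linarith
  have hdist (n : ℕ) (t : ℝ≥0) : dist (f (τ n t)) (f t) < (1 / 2) ^ n := hδ n _ _ (hτd n t)
  -- `limUnder` takes a default value where no limit exists, so the version is defined everywhere
  -- and remains progressive.
  refine ⟨fun t ω ↦ limUnder atTop fun n ↦ Z (τ n t) ω, fun i ↦ ?_, fun t ↦ ?_⟩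
  · let _ : MeasurableSpace Ω := 𝓕 i
    exact StronglyMeasurable.limUnder fun n ↦ isStronglyProgressive_floor hZ (δ n) i
  · have hZt : ∀ᵐ ω ∂P, ∀ n, f (τ n t) ω = Z (τ n t) ω := ae_all_iff.2 fun n ↦ hfZ _
    have hlim : Tendsto (fun n ↦ f (τ n t)) atTop (𝓝 (f t)) := by
      rw [tendsto_iff_dist_tendsto_zero]
      exact squeeze_zero (fun _ ↦ dist_nonneg) (fun n ↦ (hdist n t).le)
        (tendsto_pow_atTop_nhds_zero_of_lt_one (by norm_num) (by norm_num))
    have hcau : ∀ᵐ ω ∂P, ∃ l, Tendsto (fun n ↦ f (τ n t) ω) atTop (𝓝 l) := by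
      refine Lp.ae_tendsto_of_cauchy_eLpNorm (p := 2)
        (fun n ↦ (Lp.aestronglyMeasurable (f (τ n t)))) (by norm_num)
        (B := fun n ↦ ENNReal.ofReal (2 * (1 / 2) ^ n)) ?_ fun N n m hn hm ↦ ?_
      · rw [← ENNReal.ofReal_tsum_of_nonneg (fun n ↦ by positivity)
          ((summable_geometric_of_lt_one (by norm_num) (by norm_num)).mul_left 2)]
        exact ENNReal.ofReal_ne_top
      · rw [← Lp.edist_def, edist_dist]
        refine (ENNReal.ofReal_lt_ofReal_iff (by positivity)).2 ?_
        have h1 : ((1 : ℝ) / 2) ^ n ≤ (1 / 2) ^ N :=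
          pow_le_pow_of_le_one (by norm_num) (by norm_num) hn
        have h2 : ((1 : ℝ) / 2) ^ m ≤ (1 / 2) ^ N :=
          pow_le_pow_of_le_one (by norm_num) (by norm_num) hm
        linarith [dist_triangle_right (f (τ n t)) (f (τ m t)) (f t), hdist n t, hdist m t]
    -- The almost sure limit is identified with f t along a subsequence, extracted from the L²
    -- convergence.
    obtain ⟨ns, hns, hsub⟩ := (tendstoInMeasure_of_tendsto_Lp hlim).exists_seq_tendsto_ae
    filter_upwards [hZt, hcau, hsub] with ω h1 ⟨l, h2⟩ h3
    have hl : l = f t ω := tendsto_nhds_unique (h2.comp hns.tendsto_atTop) h3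
    simp only [← h1]
    rw [h2.limUnder_eq, hl]

theorem measurable_uncurry_of_isStronglyProgressive {Ω : Type*} {mΩ : MeasurableSpace Ω}
    {𝓕 : Filtration ℝ≥0 mΩ} {Y : ℝ≥0 → Ω → ℝ} (hY : IsStronglyProgressive 𝓕 Y) :
    Measurable (Function.uncurry Y) := by
  have hn (n : ℕ) : Measurable fun p : ℝ≥0 × Ω ↦ Y (min p.1 n) p.2 := by
    have h1 : Measurable fun p : Iic (n : ℝ≥0) × Ω ↦ Y p.1 p.2 :=
      (hY n).measurable.mono (sup_le_sup le_rfl (MeasurableSpace.comap_mono (𝓕.le _))) le_rfl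
    exact h1.comp (((measurable_fst.min measurable_const).subtype_mk
      (h := fun p ↦ mem_Iic.2 (min_le_right _ _))).prodMk measurable_snd)
  refine measurable_of_tendsto_metrizable hn (tendsto_pi_nhds.2 fun p ↦ ?_)
  refine tendsto_const_nhds.congr' ?_
  filter_upwards [eventually_ge_atTop ⌈p.1⌉₊] with n hn
  rw [min_eq_left (Nat.ceil_le.1 hn), Function.uncurry]

/-! ### Adaptedness of the Wiener integral -/

theorem coeFn_stepFunction_single (t : ℝ≥0) (a : ℝ) :
    stepFunction (Finsupp.single t a) =ᵐ[(volume : Measure ℝ).restrict (Ioi 0)]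
      (Ioc (0 : ℝ) t).indicator fun _ ↦ a := by
  rw [stepFunction, Finsupp.linearCombination_single]
  filter_upwards [Lp.coeFn_smul a (indicatorConstLp 2 (measurableSet_Ioc (a := (0 : ℝ))
      (b := (t : ℝ))) (((Measure.restrict_apply_le _ _).trans_lt
      measure_Ioc_lt_top).ne) (1 : ℝ) : Integrands),
    indicatorConstLp_coeFn (p := 2) (μ := (volume : Measure ℝ).restrict (Ioi 0))
      (hs := measurableSet_Ioc (a := (0 : ℝ)) (b := (t : ℝ)))
      (hμs := ((Measure.restrict_apply_le _ _).trans_lt measure_Ioc_lt_top).ne) (c := (1 : ℝ))]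
    with s h1 h2
  rw [h1, Pi.smul_apply, h2, indicator_apply, indicator_apply]
  split_ifs <;> simp

/-- Since 1_{(0,t]} 1_{(0,u]} = 1_{(0,min t u]}, truncating a step function at t amounts to moving
its nodes by `min t`. On the stochastic side this leaves only values of W up to time t. -/
theorem coeFn_stepFunction_mapDomain_min (t : ℝ≥0) (c : ℝ≥0 →₀ ℝ) :
    stepFunction (c.mapDomain (min t)) =ᵐ[(volume : Measure ℝ).restrict (Ioi 0)]
      (Ioc (0 : ℝ) t).indicator (stepFunction c) := by
  induction c using Finsupp.induction_linear with
  | zero =>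
    simp only [Finsupp.mapDomain_zero, map_zero]
    filter_upwards [Lp.coeFn_zero ℝ 2 ((volume : Measure ℝ).restrict (Ioi 0))] with s hs
    rw [indicator_apply, hs, Pi.zero_apply, ite_self]
  | add c d hc hd =>
    simp only [Finsupp.mapDomain_add, map_add]
    filter_upwards [hc, hd, Lp.coeFn_add (stepFunction c) (stepFunction d),
      Lp.coeFn_add (stepFunction (c.mapDomain (min t))) (stepFunction (d.mapDomain (min t)))]
      with s h1 h2 h3 h4
    rw [h4, Pi.add_apply, h1, h2]
    by_cases hs : s ∈ Ioc (0 : ℝ) t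
    · simp only [indicator_of_mem hs, h3, Pi.add_apply]
    · simp only [indicator_of_notMem hs, add_zero]
  | single u a =>
    rw [Finsupp.mapDomain_single]
    filter_upwards [coeFn_stepFunction_single (min t u) a, coeFn_stepFunction_single u a]
      with s h1 h2
    rw [h1, indicator_apply, indicator_apply, h2, indicator_apply]
    by_cases hst : s ≤ t <;> by_cases hsu : s ≤ u <;> by_cases hs : 0 < s <;>
      simp [hst, hsu, hs]

theorem aestronglyMeasurable_stepIntegral_mapDomain_min {Ω : Type*} {mΩ : MeasurableSpace Ω}
    {W : ℝ≥0 → Ω → ℝ} {P : Measure Ω} (hW : IsPreBrownianReal W P) {𝓕 : Filtration ℝ≥0 mΩ}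
    (ha : StronglyAdapted 𝓕 W) (t : ℝ≥0) (c : ℝ≥0 →₀ ℝ) :
    AEStronglyMeasurable[𝓕 t] (stepIntegral hW (c.mapDomain (min t))) P := by
  rw [← mem_lpMeas_iff_aestronglyMeasurable (𝕜 := ℝ) (F := ℝ)]
  induction c using Finsupp.induction_linear with
  | zero => simp
  | add c d hc hd =>
    rw [Finsupp.mapDomain_add, map_add]
    exact add_mem hc hd
  | single u a =>
    rw [Finsupp.mapDomain_single, stepIntegral, Finsupp.linearCombination_single]
    refine Submodule.smul_mem _ _ (mem_lpMeas_iff_aestronglyMeasurable.2 ?_)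
    exact ⟨W (min t u), (ha _).mono (𝓕.mono (min_le_left _ _)), MemLp.coeFn_toLp _⟩

/-- The Wiener integral of a function supported in `(0, t]` is determined at time `t`. -/
theorem aestronglyMeasurable_wienerIntegral {Ω : Type*} {mΩ : MeasurableSpace Ω}
    {W : ℝ≥0 → Ω → ℝ} {P : Measure Ω} (hW : IsPreBrownianReal W P) {𝓕 : Filtration ℝ≥0 mΩ}
    (ha : StronglyAdapted 𝓕 W) (t : ℝ≥0) (h : Integrands)
    (hh : ∀ᵐ s ∂(volume : Measure ℝ).restrict (Ioi 0), s ∉ Ioc (0 : ℝ) t → h s = 0) :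
    AEStronglyMeasurable[𝓕 t] (wienerIntegral hW h) P := by
  -- As h vanishes off (0,t], truncating an approximating step function to (0,t] cannot increase its
  -- distance to h.
  have hcl : h ∈ closure (range fun c : ℝ≥0 →₀ ℝ ↦ stepFunction (c.mapDomain (min t))) := by
    refine Metric.mem_closure_iff.2 fun ε hε ↦ ?_
    obtain ⟨c, hc⟩ := denseRange_stepFunction.exists_dist_lt h hε
    refine ⟨_, ⟨c, rfl⟩, lt_of_le_of_lt ?_ hc⟩
    rw [dist_eq_norm, dist_eq_norm]
    refine Lp.norm_le_norm_of_ae_le ?_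
    filter_upwards [hh, coeFn_stepFunction_mapDomain_min t c, Lp.coeFn_sub h (stepFunction c),
      Lp.coeFn_sub h (stepFunction (c.mapDomain (min t)))] with s h1 h2 h3 h4
    rw [h3, h4, Pi.sub_apply, Pi.sub_apply, h2]
    by_cases hs : s ∈ Ioc (0 : ℝ) t
    · rw [indicator_of_mem hs]
    · rw [indicator_of_notMem hs, h1 hs]
      simp
  have hcl' : IsClosed {f : Lp ℝ 2 P | AEStronglyMeasurable[𝓕 t] f P} :=
    isClosed_aestronglyMeasurable (𝓕.le t)
  refine closure_minimal ?_ (hcl'.preimage (wienerIntegral hW).continuous) hcl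
  rintro _ ⟨c, rfl⟩
  rw [mem_preimage, wienerIntegral_stepFunction]
  exact aestronglyMeasurable_stepIntegral_mapDomain_min hW ha t c

theorem IsWienerIntegral.aestronglyMeasurable {Ω : Type*} {mΩ : MeasurableSpace Ω}
    {W : ℝ≥0 → Ω → ℝ} {P : Measure Ω} {hW : IsPreBrownianReal W P} {𝓕 : Filtration ℝ≥0 mΩ}
    (ha : StronglyAdapted 𝓕 W) {f : ℝ → ℝ} {t : ℝ≥0} {Y : Ω → ℝ}
    (hY : IsWienerIntegral hW f t Y) : AEStronglyMeasurable[𝓕 t] Y P := by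
  obtain ⟨hf, hY⟩ := hY
  refine (aestronglyMeasurable_wienerIntegral hW ha t (hf.toLp _) ?_).congr hY.symm
  filter_upwards [hf.coeFn_toLp] with s hs hst
  rw [hs, indicator_of_notMem hst]

/-- Completeness puts every subset of the exceptional set {X ≠ Z} into 𝓕_t, so changing Z to X there
preserves measurability. -/
theorem UsualConditions.stronglyMeasurable {Ω : Type*} {mΩ : MeasurableSpace Ω}
    {𝓕 : Filtration ℝ≥0 mΩ} {P : Measure Ω} (h𝓕 : UsualConditions 𝓕 P) {t : ℝ≥0} {X : Ω → ℝ}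
    (hX : AEStronglyMeasurable[𝓕 t] X P) : StronglyMeasurable[𝓕 t] X := by
  obtain ⟨Z, hZ, hXZ⟩ := hX
  have hnull (A : Set Ω) (hA : P A = 0) : MeasurableSet[𝓕 t] A :=
    𝓕.mono zero_le _ (h𝓕.complete A hA)
  refine Measurable.stronglyMeasurable fun B hB ↦ ?_
  have hN : P {ω | X ω ≠ Z ω} = 0 := hXZ
  have heq : X ⁻¹' B = (Z ⁻¹' B \ {ω | X ω ≠ Z ω}) ∪ (X ⁻¹' B ∩ {ω | X ω ≠ Z ω}) := by
    ext ω
    by_cases h : X ω = Z ω <;> simp [h]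
  rw [heq]
  exact ((hZ.measurable hB).diff (hnull _ hN)).union
    (hnull _ (measure_mono_null inter_subset_right hN))

/-! ### The convolution kernel as a curve in `L²` -/

/-- The curve `r ↦ g (r - ·)` in `L²((0, ∞))`. -/
def shiftedKernel {g : ℝ → ℝ} (hg : MemLp g 2 volume) (r : ℝ) : Integrands :=
  LpToLpRestrictCLM ℝ ℝ ℝ volume 2 (Ioi 0)
    (Lp.compMeasurePreserving (fun s ↦ r - s) (Measure.measurePreserving_sub_left volume r)
      (hg.toLp g))

theorem coeFn_shiftedKernel {g : ℝ → ℝ} (hg : MemLp g 2 volume) (r : ℝ) :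
    shiftedKernel hg r =ᵐ[(volume : Measure ℝ).restrict (Ioi 0)] fun s ↦ g (r - s) := by
  have hmp := Measure.measurePreserving_sub_left (volume : Measure ℝ) r
  filter_upwards [LpToLpRestrictCLM_coeFn ℝ (Ioi 0)
      (Lp.compMeasurePreserving (fun s ↦ r - s) hmp (hg.toLp g)),
    ae_restrict_of_ae (Lp.coeFn_compMeasurePreserving (hg.toLp g) hmp),
    ae_restrict_of_ae (hmp.quasiMeasurePreserving.ae_eq_comp hg.coeFn_toLp)] with s h1 h2 h3
  exact h1.trans (h2.trans h3)

/-- Strong continuity of translations in L², which requires a finite exponent. -/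
theorem continuous_shiftedKernel {g : ℝ → ℝ} (hg : MemLp g 2 volume) :
    Continuous (shiftedKernel hg) := by
  let φ : ℝ → C(ℝ, ℝ) := (ContinuousMap.mk (fun a : ℝ × ℝ ↦ a.1 - a.2) continuous_sub).curry
  have h : Continuous fun r ↦ Lp.compMeasurePreserving (φ r)
      (Measure.measurePreserving_sub_left volume r) (hg.toLp g) :=
    (continuous_const (y := hg.toLp g)).compMeasurePreservingLp
      (ContinuousMap.continuous _) (fun r ↦ Measure.measurePreserving_sub_left volume r)
      ENNReal.ofNat_ne_top
  exact (LpToLpRestrictCLM ℝ ℝ ℝ volume 2 (Ioi 0)).continuous.comp h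

/-! ### The drift kernel and its primitive -/

/-- The derivative of `K` on `[0, T)`, extended by zero. -/
def driftKernel (K : ℝ → ℝ) (T : ℝ≥0) : ℝ → ℝ := (Ico (0 : ℝ) T).indicator (deriv K)

theorem measurable_driftKernel (K : ℝ → ℝ) (T : ℝ≥0) : Measurable (driftKernel K T) :=
  (measurable_deriv K).indicator measurableSet_Ico

theorem memLp_driftKernel {K : ℝ → ℝ} {T : ℝ≥0}
    (hK' : MemLp (deriv K) 2 ((volume : Measure ℝ).restrict (Icc 0 (T : ℝ)))) :
    MemLp (driftKernel K T) 2 volume :=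
  (memLp_indicator_iff_restrict measurableSet_Ico).2
    (hK'.mono_measure (Measure.restrict_mono Ico_subset_Icc_self le_rfl))

theorem driftKernel_of_neg (K : ℝ → ℝ) (T : ℝ≥0) {u : ℝ} (hu : u < 0) : driftKernel K T u = 0 :=
  indicator_of_notMem (fun h ↦ hu.not_ge h.1) _

theorem driftKernel_of_mem (K : ℝ → ℝ) {T : ℝ≥0} {u : ℝ} (hu : u ∈ Ico (0 : ℝ) T) :
    driftKernel K T u = deriv K u :=
  indicator_of_mem hu _

/-- The half-open interval [0,T) fits exactly: s > 0 forces t - s < T, and s = t gives the included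
endpoint 0. One kernel thus serves all t ≤ T. -/
theorem indicator_deriv_eq_driftKernel (K : ℝ → ℝ) {t T : ℝ≥0} (htT : t ≤ T) {s : ℝ}
    (hs : 0 < s) :
    (Ioc (0 : ℝ) t).indicator (fun s ↦ deriv K (t - s)) s = driftKernel K T (t - s) := by
  have : (t : ℝ) ≤ T := htT
  by_cases h : s ≤ t
  · rw [driftKernel, indicator_of_mem (show s ∈ Ioc (0 : ℝ) t from ⟨hs, h⟩), indicator_of_mem]
    exact ⟨by linarith, by linarith⟩
  · rw [driftKernel_of_neg K T (by linarith), indicator_of_notMem (fun h' ↦ h h'.2)]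

/-- The zero extension kills the range r < s; after the shift by s, the rest is the integral of K'
over [0, t-s], to which the fundamental theorem for absolutely continuous functions applies. -/
theorem integral_driftKernel {K : ℝ → ℝ} {t T : ℝ≥0}
    (hK : AbsolutelyContinuousOnInterval K 0 T) (htT : t ≤ T) {s : ℝ} (hs : 0 < s) :
    ∫ r in (0 : ℝ)..t, driftKernel K T (r - s)
      = (Ioc (0 : ℝ) t).indicator (fun s ↦ K (t - s) - K 0) s := by
  have hT : (t : ℝ) ≤ T := htT
  have h0 : (0 : ℝ) ≤ t := t.coe_nonneg
  by_cases h : s ≤ t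
  · rw [indicator_of_mem (show s ∈ Ioc (0 : ℝ) t from ⟨hs, h⟩)]
    have hint : ∀ a b : ℝ, a ≤ b → b ≤ 0 → ∫ r in a..b, driftKernel K T r = 0 := by
      intro a b hab hb
      rw [intervalIntegral.integral_of_le hab, integral_Ioc_eq_integral_Ioo]
      exact setIntegral_eq_zero_of_forall_eq_zero fun r hr ↦
        driftKernel_of_neg K T (hr.2.trans_le hb)
    have hac : AbsolutelyContinuousOnInterval K 0 (t - s) :=
      hK.mono (by rw [uIcc_of_le (by linarith), uIcc_of_le (by linarith)]
                  exact Icc_subset_Icc le_rfl (by linarith))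
    have hsplit : ∫ r in (0 : ℝ)..t, driftKernel K T (r - s)
        = ∫ r in (0 : ℝ)..(t - s), driftKernel K T r := by
      have h1 : ∫ r in (0 : ℝ)..s, driftKernel K T (r - s) = 0 := by
        rw [intervalIntegral.integral_comp_sub_right]
        exact hint _ _ (by linarith) (by linarith)
      have h2 : ∫ r in s..(t : ℝ), driftKernel K T (r - s)
          = ∫ r in (0 : ℝ)..(t - s), driftKernel K T r := by
        rw [intervalIntegral.integral_comp_sub_right, sub_self]
      have hii : IntervalIntegrable (driftKernel K T) volume 0 (t - s) := by
        refine hac.intervalIntegrable_deriv.congr_uIoo fun r hr ↦ ?_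
        rw [uIoo_of_le (by linarith)] at hr
        exact (driftKernel_of_mem K ⟨hr.1.le, by linarith [hr.2]⟩).symm
      have hi2 : IntervalIntegrable (fun r ↦ driftKernel K T (r - s)) volume s t := by
        simpa using hii.comp_sub_right s
      have hi1 : IntervalIntegrable (fun r ↦ driftKernel K T (r - s)) volume 0 s := by
        refine (intervalIntegrable_const (c := (0 : ℝ))).congr_uIoo fun r hr ↦ ?_
        rw [uIoo_of_le hs.le] at hr
        exact (driftKernel_of_neg K T (by linarith [hr.2])).symm
      rw [← intervalIntegral.integral_add_adjacent_intervals hi1 hi2, h1, h2, zero_add]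
    rw [hsplit, ← hac.integral_deriv_eq_sub]
    refine intervalIntegral.integral_congr_uIoo fun r hr ↦ ?_
    rw [uIoo_of_le (by linarith)] at hr
    exact driftKernel_of_mem K ⟨hr.1.le, by linarith [hr.2]⟩
  · rw [indicator_of_notMem (fun h' ↦ h h'.2), intervalIntegral.integral_of_le h0]
    exact setIntegral_eq_zero_of_forall_eq_zero fun r hr ↦
      driftKernel_of_neg K T (by linarith [hr.2])

theorem isWienerIntegral_deriv_iff {Ω : Type*} {mΩ : MeasurableSpace Ω} {W : ℝ≥0 → Ω → ℝ}
    {P : Measure Ω} (hW : IsPreBrownianReal W P) {K : ℝ → ℝ} {t T : ℝ≥0} (htT : t ≤ T)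
    (hK' : MemLp (deriv K) 2 ((volume : Measure ℝ).restrict (Icc 0 (T : ℝ)))) {Y : Ω → ℝ} :
    IsWienerIntegral hW (fun s ↦ deriv K (t - s)) t Y ↔
      Y =ᵐ[P] wienerIntegral hW (shiftedKernel (memLp_driftKernel hK') t) := by
  have hae : (Ioc (0 : ℝ) t).indicator (fun s ↦ deriv K (t - s))
      =ᵐ[(volume : Measure ℝ).restrict (Ioi 0)] shiftedKernel (memLp_driftKernel hK') t := by
    filter_upwards [coeFn_shiftedKernel (memLp_driftKernel hK') t,
      ae_restrict_mem measurableSet_Ioi] with s h1 h2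
    rw [h1, indicator_deriv_eq_driftKernel K htT h2]
  have hm : MemLp ((Ioc (0 : ℝ) t).indicator (fun s ↦ deriv K (t - s))) 2
      ((volume : Measure ℝ).restrict (Ioi 0)) := (memLp_congr_ae hae).2 (Lp.memLp _)
  have heq : hm.toLp _ = shiftedKernel (memLp_driftKernel hK') t :=
    Lp.ext (hm.coeFn_toLp.trans hae)
  exact ⟨fun ⟨_, h⟩ ↦ heq ▸ h, fun h ↦ ⟨hm, heq ▸ h⟩⟩

theorem indicator_kernel_ae_eq {K : ℝ → ℝ} {t T : ℝ≥0}
    (hK : AbsolutelyContinuousOnInterval K 0 T) (htT : t ≤ T)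
    (hK' : MemLp (deriv K) 2 ((volume : Measure ℝ).restrict (Icc 0 (T : ℝ)))) :
    (Ioc (0 : ℝ) t).indicator (fun s ↦ K (t - s)) =ᵐ[(volume : Measure ℝ).restrict (Ioi 0)]
      (stepFunction (Finsupp.single t (K 0))
        + ∫ r in (0 : ℝ)..t, shiftedKernel (memLp_driftKernel hK') r : Integrands) := by
  have hY : Measurable (Function.uncurry fun r s : ℝ ↦ driftKernel K T (r - s)) :=
    (measurable_driftKernel K T).comp measurable_sub
  filter_upwards [Lp.coeFn_add (stepFunction (Finsupp.single t (K 0)))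
      (∫ r in (0 : ℝ)..t, shiftedKernel (memLp_driftKernel hK') r : Integrands),
    coeFn_intervalIntegral_Lp t.coe_nonneg (continuous_shiftedKernel (memLp_driftKernel hK')) hY
      fun r _ ↦ (coeFn_shiftedKernel (memLp_driftKernel hK') r).symm,
    coeFn_stepFunction_single t (K 0),
    ae_restrict_mem measurableSet_Ioi] with s h1 h2 h3 h4
  rw [h1, Pi.add_apply, h2, h3, integral_driftKernel hK htT h4]
  by_cases hs : s ∈ Ioc (0 : ℝ) t
  · simp only [indicator_of_mem hs]
    ring
  · simp only [indicator_of_notMem hs, add_zero]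

/-- Stochastic Fubini: the Volterra integral at time `t` is `K(0) W_t + ∫_0^t Y_r dr`. -/
theorem isWienerIntegral_iff {Ω : Type*} {mΩ : MeasurableSpace Ω} {W : ℝ≥0 → Ω → ℝ}
    {P : Measure Ω} (hW : IsPreBrownianReal W P) {K : ℝ → ℝ} {t T : ℝ≥0}
    (hK : AbsolutelyContinuousOnInterval K 0 T) (htT : t ≤ T)
    (hK' : MemLp (deriv K) 2 ((volume : Measure ℝ).restrict (Icc 0 (T : ℝ))))
    {Y : ℝ≥0 → Ω → ℝ} (hY : IsVolterraProcess hW (deriv K) T Y)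
    (hYm : Measurable (Function.uncurry Y)) {X : Ω → ℝ} :
    IsWienerIntegral hW (fun s ↦ K (t - s)) t X ↔
      X =ᵐ[P] fun ω ↦ K 0 * W t ω + ∫ r in (0 : ℝ)..t, Y r.toNNReal ω := by
  have := hW.isGaussianProcess.isProbabilityMeasure
  have hae := indicator_kernel_ae_eq hK htT hK'
  have hcont := continuous_shiftedKernel (memLp_driftKernel hK')
  have hm : MemLp ((Ioc (0 : ℝ) t).indicator (fun s ↦ K (t - s))) 2
      ((volume : Measure ℝ).restrict (Ioi 0)) := (memLp_congr_ae hae).2 (Lp.memLp _)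
  have heq : hm.toLp _ = stepFunction (Finsupp.single t (K 0))
        + ∫ r in (0 : ℝ)..t, shiftedKernel (memLp_driftKernel hK') r :=
    Lp.ext (hm.coeFn_toLp.trans hae)
  have hint : wienerIntegral hW (hm.toLp _) =ᵐ[P]
      fun ω ↦ K 0 * W t ω + ∫ r in (0 : ℝ)..t, Y r.toNNReal ω := by
    -- The Wiener integral is applied termwise: the step function gives K(0) W_t, and the Bochner
    -- integral commutes with the continuous linear map.
    rw [heq, map_add, wienerIntegral_stepFunction, stepIntegral,
      Finsupp.linearCombination_single,
      ← ContinuousLinearMap.intervalIntegral_comp_comm _ (hcont.intervalIntegrable _ _)]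
    filter_upwards [Lp.coeFn_add (K 0 • (memLp_eval hW t).toLp (W t))
        (∫ r in (0 : ℝ)..t, wienerIntegral hW (shiftedKernel (memLp_driftKernel hK') r)),
      Lp.coeFn_smul (K 0) ((memLp_eval hW t).toLp (W t)), (memLp_eval hW t).coeFn_toLp,
      coeFn_intervalIntegral_Lp t.coe_nonneg ((wienerIntegral hW).continuous.comp hcont)
        (Y := fun r ω ↦ Y r.toNNReal ω)
        (hYm.comp ((measurable_real_toNNReal.comp measurable_fst).prodMk measurable_snd))
        fun r hr ↦ by
          have hr' : r.toNNReal ≤ T := (Real.toNNReal_le_iff_le_coe.2 hr.2).trans htT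
          have := (isWienerIntegral_deriv_iff hW hr' hK').1 (hY _ hr')
          rwa [Real.coe_toNNReal _ hr.1.le] at this] with ω h1 h2 h3 h4
    rw [h1, Pi.add_apply, h2, Pi.smul_apply, h3, smul_eq_mul]
    exact congrArg _ h4
  exact ⟨fun ⟨_, h⟩ ↦ h.trans hint, fun h ↦ ⟨hm, h.trans hint.symm⟩⟩

theorem IsVolterraProcess.ae_intervalIntegrable {Ω : Type*} {mΩ : MeasurableSpace Ω}
    {W : ℝ≥0 → Ω → ℝ} {P : Measure Ω} {hW : IsPreBrownianReal W P} {K : ℝ → ℝ} {T : ℝ≥0}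
    (hK' : MemLp (deriv K) 2 ((volume : Measure ℝ).restrict (Icc 0 (T : ℝ))))
    {Y : ℝ≥0 → Ω → ℝ} (hY : IsVolterraProcess hW (deriv K) T Y)
    (hYm : Measurable (Function.uncurry Y)) :
    ∀ᵐ ω ∂P, IntervalIntegrable (fun r : ℝ ↦ Y r.toNNReal ω) volume 0 T := by
  have := hW.isGaussianProcess.isProbabilityMeasure
  refine ae_intervalIntegrable_of_continuous_Lp T.coe_nonneg ((wienerIntegral hW).continuous.comp
    (continuous_shiftedKernel (memLp_driftKernel hK')))
    (hYm.comp ((measurable_real_toNNReal.comp measurable_fst).prodMk measurable_snd))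
    fun r hr ↦ ?_
  have hr' : r.toNNReal ≤ T := Real.toNNReal_le_iff_le_coe.2 hr.2
  have := (isWienerIntegral_deriv_iff hW hr' hK').1 (hY _ hr')
  rwa [Real.coe_toNNReal _ hr.1.le] at this

theorem exists_isStronglyProgressive_drift {Ω : Type*} {mΩ : MeasurableSpace Ω}
    {W : ℝ≥0 → Ω → ℝ} {P : Measure Ω} (hW : IsPreBrownianReal W P) {𝓕 : Filtration ℝ≥0 mΩ}
    (ha : StronglyAdapted 𝓕 W) {K : ℝ → ℝ} {T : ℝ≥0}
    (hK' : MemLp (deriv K) 2 ((volume : Measure ℝ).restrict (Icc 0 (T : ℝ)))) :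
    ∃ Y : ℝ≥0 → Ω → ℝ, IsVolterraProcess hW (deriv K) T Y ∧ IsStronglyProgressive 𝓕 Y := by
  let k : ℝ≥0 → Lp ℝ 2 P :=
    fun t ↦ wienerIntegral hW (shiftedKernel (memLp_driftKernel hK') t)
  have hk : Continuous k := (wienerIntegral hW).continuous.comp
    ((continuous_shiftedKernel (memLp_driftKernel hK')).comp NNReal.continuous_coe)
  -- Freezing the curve at T makes it uniformly continuous by compactness of [0,T]; times beyond T
  -- are irrelevant.
  have huc : UniformContinuous fun t : ℝ≥0 ↦ k (min t T) := by
    have h1 := (isCompact_Icc (a := (0 : ℝ≥0)) (b := T)).uniformContinuousOn_of_continuous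
      hk.continuousOn
    refine Metric.uniformContinuous_iff.2 fun ε hε ↦ ?_
    obtain ⟨δ, hδ, h⟩ := Metric.uniformContinuousOn_iff.1 h1 ε hε
    refine ⟨δ, hδ, fun {s t} hst ↦ h _ ⟨zero_le, min_le_right _ _⟩ _
      ⟨zero_le, min_le_right _ _⟩ (lt_of_le_of_lt ?_ hst)⟩
    rw [NNReal.dist_eq, NNReal.dist_eq, NNReal.coe_min, NNReal.coe_min]
    simpa using abs_min_sub_min_le_max (s : ℝ) T t T
  obtain ⟨Y, hY, hYk⟩ := exists_isStronglyProgressive_version (𝓕 := 𝓕) huc fun t ↦ by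
    refine aestronglyMeasurable_wienerIntegral hW ha t _ ?_
    filter_upwards [coeFn_shiftedKernel (memLp_driftKernel hK') (min t T : ℝ≥0),
      ae_restrict_mem measurableSet_Ioi] with s h1 h2 h3
    rw [h1]
    refine driftKernel_of_neg K T ?_
    have h4 : (t : ℝ) < s := not_le.1 fun h ↦ h3 ⟨h2, h⟩
    have h5 : ((min t T : ℝ≥0) : ℝ) ≤ t := NNReal.coe_le_coe.2 (min_le_left _ _)
    linarith
  refine ⟨Y, fun t ht ↦ (isWienerIntegral_deriv_iff hW ht hK').2 ?_, hY⟩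
  have := hYk t
  rwa [min_eq_left ht] at this

/-! ### Paths and martingales -/

theorem _root_.Continuous.isCadlag {x : ℝ≥0 → ℝ} (hx : Continuous x) : IsCadlag x :=
  fun t ↦ ⟨hx.continuousWithinAt, x t, hx.continuousWithinAt⟩

/-- In [0,∞) every t is a limit of points of D from the right, so right-continuity of x is enough.
-/
theorem IsCadlag.eq_of_eqOn_dense {x y : ℝ≥0 → ℝ} (hx : IsCadlag x) (hy : Continuous y)
    {D : Set ℝ≥0} (hD : Dense D) (hxy : EqOn x y D) : x = y := by
  funext t
  have hmem : t ∈ closure (Ioi t ∩ D) :=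
    closure_minimal (hD.open_subset_closure_inter isOpen_Ioi) isClosed_closure
      (by rw [closure_Ioi]; exact self_mem_Ici)
  have hne : (𝓝[Ioi t ∩ D] t).NeBot := mem_closure_iff_nhdsWithin_neBot.1 hmem
  have h1 : Tendsto x (𝓝[Ioi t ∩ D] t) (𝓝 (x t)) :=
    (hx t).1.mono (inter_subset_left.trans Ioi_subset_Ici_self)
  have h2 : Tendsto y (𝓝[Ioi t ∩ D] t) (𝓝 (y t)) := hy.continuousWithinAt
  refine tendsto_nhds_unique (h1.congr' ?_) h2
  filter_upwards [self_mem_nhdsWithin] with s hs using hxy hs.2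

theorem continuous_primitive_min {f : ℝ → ℝ} {T : ℝ≥0} (hf : IntervalIntegrable f volume 0 T) :
    Continuous fun t : ℝ≥0 ↦ ∫ r in (0 : ℝ)..(min t T : ℝ≥0), f r := by
  have hf' := (intervalIntegrable_iff_integrableOn_Icc_of_le T.coe_nonneg).1 hf
  rw [← uIcc_of_le T.coe_nonneg] at hf'
  have h := intervalIntegral.continuousOn_primitive_interval hf'
  refine h.comp_continuous (NNReal.continuous_coe.comp (continuous_id.min continuous_const))
    fun t ↦ ?_
  rw [uIcc_of_le T.coe_nonneg]
  exact ⟨NNReal.coe_nonneg _, NNReal.coe_le_coe.2 (min_le_right _ _)⟩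

/-- A primitive is absolutely continuous, hence of bounded variation on [0,T], and composing with
the monotone map t ↦ min t T does not increase the variation. -/
theorem locallyBoundedVariationOn_primitive_min {f : ℝ → ℝ} {T : ℝ≥0}
    (hf : IntervalIntegrable f volume 0 T) :
    LocallyBoundedVariationOn (fun t : ℝ≥0 ↦ ∫ r in (0 : ℝ)..(min t T : ℝ≥0), f r) univ := by
  have h := (hf.absolutelyContinuousOnInterval_intervalIntegral
    (left_mem_uIcc (a := (0 : ℝ)) (b := T))).boundedVariationOn
  refine BoundedVariationOn.locallyBoundedVariationOn (ne_top_of_le_ne_top h ?_)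
  refine eVariationOn.comp_le_of_monotoneOn (fun x ↦ ∫ r in (0 : ℝ)..x, f r)
    (fun t : ℝ≥0 ↦ ((min t T : ℝ≥0) : ℝ)) ?_ ?_
  · exact fun s _ t _ hst ↦ NNReal.coe_le_coe.2 (min_le_min_right _ hst)
  · intro t _
    rw [uIcc_of_le T.coe_nonneg]
    exact ⟨NNReal.coe_nonneg _, NNReal.coe_le_coe.2 (min_le_right _ _)⟩

theorem IsBrownianMotion.martingale {Ω : Type*} {mΩ : MeasurableSpace Ω} {W : ℝ≥0 → Ω → ℝ}
    {𝓕 : Filtration ℝ≥0 mΩ} {P : Measure Ω} [IsProbabilityMeasure P]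
    (hW : IsBrownianMotion W 𝓕 P) : Martingale W 𝓕 P := by
  refine ⟨hW.adapted, fun s t hst ↦ ?_⟩
  have hi := hW.toIsPreBrownianReal.integrable_eval
  have hmeas (u : ℝ≥0) : Measurable (W u) := ((hW.adapted u).mono (𝓕.le u)).measurable
  have h1 : P[fun ω ↦ W t ω - W s ω | 𝓕 s] =ᵐ[P] fun _ ↦ ∫ ω, (W t ω - W s ω) ∂P :=
    condExp_indep_eq ((hmeas t).sub (hmeas s)).comap_le (𝓕.le s)
      (comap_measurable _).stronglyMeasurable (hW.indep s t hst)
  have h2 : ∫ ω, (W t ω - W s ω) ∂P = 0 := by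
    rw [integral_sub (hi t) (hi s), hW.toIsPreBrownianReal.integral_eval,
      hW.toIsPreBrownianReal.integral_eval, sub_zero]
  have h3 : P[fun ω ↦ W t ω - W s ω | 𝓕 s] =ᵐ[P] P[W t | 𝓕 s] - P[W s | 𝓕 s] :=
    condExp_sub (hi t) (hi s) _
  rw [condExp_of_stronglyMeasurable (𝓕.le s) (hW.adapted s) (hi s)] at h3
  filter_upwards [h1, h3] with ω h1 h3
  rw [h1, h2, Pi.sub_apply] at h3
  linarith

theorem _root_.MeasureTheory.Martingale.upTo {Ω : Type*} {mΩ : MeasurableSpace Ω}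
    {M : ℝ≥0 → Ω → ℝ} {𝓕 : Filtration ℝ≥0 mΩ} {P : Measure Ω} [IsFiniteMeasure P]
    (hM : Martingale M 𝓕 P) (T : ℝ≥0) : Martingale (upTo T M) 𝓕 P := by
  refine ⟨fun t ↦ (hM.stronglyMeasurable _).mono (𝓕.mono (min_le_left t T)), fun s t hst ↦ ?_⟩
  rcases le_total s T with hs | hs
  · change P[M (min t T) | 𝓕 s] =ᵐ[P] M (min s T)
    rw [min_eq_left hs]
    exact hM.condExp_ae_eq (le_min hst hs)
  · change P[M (min t T) | 𝓕 s] =ᵐ[P] M (min s T)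
    rw [min_eq_right hs, min_eq_right (hs.trans hst), condExp_of_stronglyMeasurable (𝓕.le s)
      ((hM.stronglyMeasurable T).mono (𝓕.mono hs)) (hM.integrable T)]

/-! ### The dynamics -/

/-- A càdlàg version of the Volterra process follows `X_t = K(0) W_t + ∫_0^t Y_r dr` simultaneously
for all `t ≤ T`. -/
theorem IsVolterraProcess.ae_upTo_eq {Ω : Type*} {mΩ : MeasurableSpace Ω} {W : ℝ≥0 → Ω → ℝ}
    {P : Measure Ω} (hW : IsBrownianReal W P) {K : ℝ → ℝ} {T : ℝ≥0}
    (hK : AbsolutelyContinuousOnInterval K 0 T)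
    (hK' : MemLp (deriv K) 2 ((volume : Measure ℝ).restrict (Icc 0 (T : ℝ))))
    {X Y : ℝ≥0 → Ω → ℝ} (hX : IsVolterraProcess hW.toIsPreBrownianReal K T X)
    (hXc : ∀ᵐ ω ∂P, IsCadlag (upTo T X · ω))
    (hY : IsVolterraProcess hW.toIsPreBrownianReal (deriv K) T Y)
    (hYm : Measurable (Function.uncurry Y)) :
    ∀ᵐ ω ∂P, ∀ t, upTo T X t ω
      = K 0 * upTo T W t ω + ∫ r in (0 : ℝ)..(min t T : ℝ≥0), Y r.toNNReal ω := by
  -- Countably many times, hence a single null set.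
  have hdense : ∀ᵐ ω ∂P, ∀ n, upTo T X (TopologicalSpace.denseSeq ℝ≥0 n) ω
      = K 0 * upTo T W (TopologicalSpace.denseSeq ℝ≥0 n) ω
        + ∫ r in (0 : ℝ)..(min (TopologicalSpace.denseSeq ℝ≥0 n) T : ℝ≥0), Y r.toNNReal ω :=
    ae_all_iff.2 fun n ↦ (isWienerIntegral_iff hW.toIsPreBrownianReal hK (min_le_right _ _) hK'
      hY hYm).1 (hX _ (min_le_right _ _))
  filter_upwards [hdense, hXc, hW.cont, hY.ae_intervalIntegrable hK' hYm] with ω h1 h2 h3 h4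
  have hc : Continuous fun t ↦ K 0 * upTo T W t ω
      + ∫ r in (0 : ℝ)..(min t T : ℝ≥0), Y r.toNNReal ω :=
    (continuous_const.mul (h3.comp (continuous_id.min continuous_const))).add
      (continuous_primitive_min h4)
  exact congrFun (h2.eq_of_eqOn_dense hc (TopologicalSpace.denseRange_denseSeq ℝ≥0)
    (by rintro _ ⟨n, rfl⟩; exact h1 n))

theorem IsVolterraProcess.isSemimartingale {Ω : Type*} {mΩ : MeasurableSpace Ω}
    {W : ℝ≥0 → Ω → ℝ} {P : Measure Ω} [IsProbabilityMeasure P] {𝓕 : Filtration ℝ≥0 mΩ}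
    (h𝓕 : UsualConditions 𝓕 P) (hW : IsBrownianMotion W 𝓕 P) {K : ℝ → ℝ} {T : ℝ≥0}
    (hK : AbsolutelyContinuousOnInterval K 0 T)
    (hK' : MemLp (deriv K) 2 ((volume : Measure ℝ).restrict (Icc 0 (T : ℝ))))
    {X Y : ℝ≥0 → Ω → ℝ} (hX : IsVolterraProcess hW.toIsPreBrownianReal K T X)
    (hXc : ∀ᵐ ω ∂P, IsCadlag (upTo T X · ω))
    (hY : IsVolterraProcess hW.toIsPreBrownianReal (deriv K) T Y)
    (hYm : Measurable (Function.uncurry Y)) :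
    IsSemimartingale (upTo T X) 𝓕 P := by
  have hA : ∀ᵐ ω ∂P, (fun t ↦ upTo T X t ω - K 0 * upTo T W t ω)
      = fun t ↦ ∫ r in (0 : ℝ)..(min t T : ℝ≥0), Y r.toNNReal ω := by
    filter_upwards [hX.ae_upTo_eq hW.toIsBrownianReal hK hK' hXc hY hYm] with ω hω
    funext t
    rw [hω t, add_sub_cancel_left]
  have hint := hY.ae_intervalIntegrable hK' hYm
  have hWm : Martingale (upTo T W) 𝓕 P := hW.martingale.upTo T
  -- Taking A as X - K(0)W instead of ∫ Y gives adaptedness through X; Y is only assumed jointly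
  -- measurable. The integral formula is needed only for the paths of A.
  refine ⟨K 0 • upTo T W, fun t ω ↦ upTo T X t ω - K 0 * upTo T W t ω,
    Locally.of_prop ⟨hWm.smul (K 0), ?_⟩, ⟨fun t ↦ ?_, ?_, ?_⟩, ?_⟩
  · filter_upwards [hW.cont] with ω hω
    exact (continuous_const.mul (hω.comp (continuous_id.min continuous_const))).isCadlag
  · have hXt : StronglyMeasurable[𝓕 t] (upTo T X t) :=
      (h𝓕.stronglyMeasurable ((hX _ (min_le_right t T)).aestronglyMeasurable hW.adapted)).mono
        (𝓕.mono (min_le_left t T))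
    exact hXt.sub ((hWm.stronglyMeasurable t).const_mul (K 0))
  · filter_upwards [hA, hint] with ω h1 h2
    rw [h1]
    exact (continuous_primitive_min h2).isCadlag
  · filter_upwards [hA, hint] with ω h1 h2
    rw [h1]
    exact locallyBoundedVariationOn_primitive_min h2
  · refine ae_of_all _ fun ω t ↦ ?_
    simp

theorem exists_continuous_isVolterraProcess {Ω : Type*} {mΩ : MeasurableSpace Ω}
    {W : ℝ≥0 → Ω → ℝ} {P : Measure Ω} (hW : IsBrownianReal W P) {K : ℝ → ℝ} {T : ℝ≥0}
    (hK : AbsolutelyContinuousOnInterval K 0 T)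
    (hK' : MemLp (deriv K) 2 ((volume : Measure ℝ).restrict (Icc 0 (T : ℝ))))
    {Y : ℝ≥0 → Ω → ℝ} (hY : IsVolterraProcess hW.toIsPreBrownianReal (deriv K) T Y)
    (hYm : Measurable (Function.uncurry Y)) :
    ∃ X : ℝ≥0 → Ω → ℝ, IsVolterraProcess hW.toIsPreBrownianReal K T X ∧
      ∀ᵐ ω ∂P, Continuous (upTo T X · ω) := by
  refine ⟨fun t ω ↦ K 0 * W t ω + ∫ r in (0 : ℝ)..t, Y r.toNNReal ω,
    fun t ht ↦ (isWienerIntegral_iff hW.toIsPreBrownianReal hK ht hK' hY hYm).2 .rfl, ?_⟩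
  filter_upwards [hW.cont, hY.ae_intervalIntegrable hK' hYm] with ω h1 h2
  exact (continuous_const.mul (h1.comp (continuous_id.min continuous_const))).add
    (continuous_primitive_min h2)

end GaussianVolterra

end

theorem proposition1 {Ω : Type*} [mΩ : MeasurableSpace Ω] (P : Measure Ω) [IsProbabilityMeasure P]
    (𝓕 : Filtration ℝ≥0 mΩ) (h𝓕 : GaussianVolterra.UsualConditions 𝓕 P)
    (W : ℝ≥0 → Ω → ℝ) (hW : GaussianVolterra.IsBrownianMotion W 𝓕 P)
    (T : ℝ≥0) (K : ℝ → ℝ) (hK : AbsolutelyContinuousOnInterval K 0 T)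
    (hK' : MemLp (deriv K) 2 ((volume : Measure ℝ).restrict (Set.Icc 0 (T : ℝ)))) :
    -- the process `∫_0^t K(t-s) dW_s` exists and has a continuous version on `[0, T]`,
    (∃ X : ℝ≥0 → Ω → ℝ, GaussianVolterra.IsVolterraProcess hW.toIsPreBrownianReal K T X ∧
      ∀ᵐ ω ∂P, Continuous (GaussianVolterra.upTo T X · ω)) ∧
    -- the drift `∫_0^t K'(t-s) dW_s` exists and has a progressively measurable version,
    (∃ Y : ℝ≥0 → Ω → ℝ, GaussianVolterra.IsVolterraProcess hW.toIsPreBrownianReal (deriv K) T Y ∧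
      IsStronglyProgressive 𝓕 Y) ∧
    -- and, whichever versions are taken, `X` is a semimartingale on `[0, T]` with the dynamics
    -- `dX_t = K(0) dW_t + Y_t dt`, `X_0 = 0`.
    ∀ X Y : ℝ≥0 → Ω → ℝ,
      GaussianVolterra.IsVolterraProcess hW.toIsPreBrownianReal K T X →
      (∀ᵐ ω ∂P, GaussianVolterra.IsCadlag (GaussianVolterra.upTo T X · ω)) →
      GaussianVolterra.IsVolterraProcess hW.toIsPreBrownianReal (deriv K) T Y →
      Measurable (Function.uncurry Y) →
      GaussianVolterra.IsSemimartingale (GaussianVolterra.upTo T X) 𝓕 P ∧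
      ∀ᵐ ω ∂P, IntervalIntegrable (fun r : ℝ ↦ Y r.toNNReal ω) volume 0 T ∧
        ∀ t : ℝ≥0, t ≤ T →
          X t ω = K 0 * W t ω + ∫ r in (0 : ℝ)..t, Y r.toNNReal ω := by
  obtain ⟨Y₀, hY₀, hprog⟩ := GaussianVolterra.exists_isStronglyProgressive_drift
    hW.toIsPreBrownianReal hW.adapted hK'
  refine ⟨GaussianVolterra.exists_continuous_isVolterraProcess hW.toIsBrownianReal hK hK' hY₀
    (GaussianVolterra.measurable_uncurry_of_isStronglyProgressive hprog), ⟨Y₀, hY₀, hprog⟩,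
    fun X Y hX hXc hY hYm ↦ ⟨hX.isSemimartingale h𝓕 hW hK hK' hXc hY hYm, ?_⟩⟩
  filter_upwards [hX.ae_upTo_eq hW.toIsBrownianReal hK hK' hXc hY hYm,
    hY.ae_intervalIntegrable hK' hYm] with ω h1 h2
  refine ⟨h2, fun t ht ↦ ?_⟩
  simpa only [GaussianVolterra.upTo, min_eq_left ht] using h1 t
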